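/- Setting. There are $m$ items and $n$ bidders. A valuation is a function $v:2^{[m]}\to[0,\infty)$ with $v(\emptyset)=0$ and $v(S)\le v(T)$ whenever $S\subseteq T$; it is (0/1) multi-minded if it takes values in $\{0,1\}$. For $d\ge 1$, a $d$-duplicate allocation is a tuple $(S_1,\dots,S_n)$ of subsets of $[m]$ such that every item lies in at most $d$ of them; a $1$-duplicate allocation (pairwise disjoint sets) is simply called an allocation. The social welfare of $(S_i)_i$ under $v_1,\dots,v_n$ is $\sum_i v_i(S_i)$. A mechanism is a deterministic communication protocol: bidder $i$ holds $v_i$; in each round an arbitrary yes/no question about a single $v_i$, which may depend on all earlier answers, is put to bidder $i$, whose answer costs one bit; at the end the protocol outputs a tuple of bundles and a vector of nonnegative prices. Its communication on $(v_1,\dots,v_n)$ is the number of bits transmitted. A mechanism for auctions with $d$ duplicates is VCG-based (maximal-in-range) if there is a fixed set $\mathcal H$ of $d$-duplicate allocations such that on every input $(v_1,\dots,v_n)$ its output is an element of $\mathcal H$ that maximizes the social welfare over $\mathcal H$. It has approximation ratio $\alpha$ with respect to multi-minded valuations if for all multi-minded $v_1,\dots,v_n$ and every allocation $(S_i)_i$,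 the social welfare of its output is at least $\frac1\alpha\sum_i v_i(S_i)$ (in particular this holds if its output is within a factor $\alpha$ of the best $d$-duplicate allocation). Theorem. For every integer $d\ge1$ and every real $\varepsilon>0$ there is $m_0=m_0(d,\varepsilon)$ such that for all $m\ge m_0$ and all $n\ge m^{1-3\varepsilon/4}$ the following holds. Every VCG-based mechanism for combinatorial auctions with $d$ duplicates, $m$ items and $n$ bidders with multi-minded valuations that has approximation ratio $m^{1-\varepsilon}$ with respect to multi-minded valuations transmits, for some multi-minded $v_1,\dots,v_n$, at least $\exp\!\left(m^{\varepsilon/2}\right)$ bits. -/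

import Mathlib

open scoped NNReal

namespace CombAuction

/-- A valuation over bundles of `m` items: normalized and nondecreasing
(and hence nonnegative). -/
structure Valuation (m : ℕ) where
  toFun : Finset (Fin m) → ℝ
  map_empty' : toFun ∅ = 0
  mono' : Monotone toFun

instance (m : ℕ) : CoeFun (Valuation m) (fun _ => Finset (Fin m) → ℝ) := ⟨Valuation.toFun⟩

/-- The class of (0/1) multi-minded valuations: all valuations with values in `{0, 1}`. -/
def MultiMinded (m : ℕ) : Set (Valuation m) := {v | ∀ S, v S = 0 ∨ v S = 1}

/-- A collection of `n` bundles of the `m` items, bidder `i` receiving the bundle `S i`. -/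
abbrev Bundles (n m : ℕ) : Type := Fin n → Finset (Fin m)

/-- An allocation: the bundles are pairwise disjoint. -/
def IsAllocation {n m : ℕ} (S : Bundles n m) : Prop :=
  ∀ i j, i ≠ j → Disjoint (S i) (S j)

/-- A `d`-duplicate allocation: every item belongs to at most `d` of the bundles. -/
def IsDuplicateAllocation {n m : ℕ} (d : ℕ) (S : Bundles n m) : Prop :=
  ∀ x : Fin m, (Finset.univ.filter fun i => x ∈ S i).card ≤ d

/-- The social welfare `∑ i, v i (S i)`. -/
def welfare {n m : ℕ} (v : Fin n → Valuation m) (S : Bundles n m) : ℝ := ∑ i, v i (S i)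

/-- A deterministic communication protocol among parties indexed by `ι`, each holding a private
input in `V`. In every round an arbitrary one-bit question is put to one party, which answers
according to its own input alone; the party and the question may depend on all previous answers.
(A question with an `ℓ`-bit answer is `ℓ` one-bit questions.) -/
inductive Protocol (ι V Out : Type) : Type
  | output (o : Out) : Protocol ι V Out
  | ask (i : ι) (q : V → Bool) (next : Bool → Protocol ι V Out) : Protocol ι V Out

namespace Protocol

variable {ι V Out : Type}

/-- The output of the protocol on the inputs `v`. -/
def result : Protocol ι V Out → (ι → V) → Out
  | output o, _ => o
  | ask i q next, v => (next (q (v i))).result v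

/-- The number of bits transmitted by the parties when the protocol runs on the inputs `v`. -/
def bits : Protocol ι V Out → (ι → V) → ℕ
  | output _, _ => 0
  | ask i q next, v => (next (q (v i))).bits v + 1

end Protocol

/-- A mechanism for `n` bidders with valuations from the class `F`, in the communication model:
a protocol among the bidders, whose output is a bundle and a price for each bidder. -/
abbrev Mechanism (n m : ℕ) (F : Set (Valuation m)) : Type :=
  Protocol (Fin n) F (Bundles n m × (Fin n → ℝ≥0))

namespace Mechanism

variable {n m : ℕ} {F : Set (Valuation m)}

/-- The bundles that the mechanism allocates on the valuations `v`. -/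
def bundles (M : Mechanism n m F) (v : Fin n → F) : Bundles n m := (M.result v).1

/-- `M` is VCG-based, or maximal-in-range, for auctions with `d` copies of each item: there is a
fixed bank `H` of `d`-duplicate allocations, and on all valuations the output of `M` is an element
of `H` whose social welfare is maximal in `H`. -/
def IsVCGBased (d : ℕ) (M : Mechanism n m F) : Prop :=
  ∃ H : Set (Bundles n m), (∀ S ∈ H, IsDuplicateAllocation d S) ∧
    ∀ v : Fin n → F, M.bundles v ∈ H ∧
      ∀ S ∈ H, welfare (fun i => (v i : Valuation m)) S ≤
        welfare (fun i => (v i : Valuation m)) (M.bundles v)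

/-- `M` has approximation ratio `α` with respect to `F`: on all valuations from `F`, the social
welfare of the output is at least `1 / α` times that of every allocation of the items. (Measuring
against `d`-duplicate allocations as well would be a stronger requirement.) -/
def HasApproxRatio (M : Mechanism n m F) (α : ℝ) : Prop :=
  ∀ (v : Fin n → F) (S : Bundles n m), IsAllocation S →
    1 / α * welfare (fun i => (v i : Valuation m)) S ≤
      welfare (fun i => (v i : Valuation m)) (M.bundles v)

end Mechanism

end CombAuction

/-! Let `k > d`. The approximation ratio forces the bank to serve, in every partition of the items
among a suitable number of bidders, some `k` of them completely. As there are few choices of the `k`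
bidders, a Sauer–Shelah type lemma yields fixed `k` bidders and a large set `T` of items such that
the bank realizes every way of splitting `T` among these bidders.

Now the `k` bidders are promoted one after another from receiving their part of `T` to receiving all
of it. If few bits are transmitted, a fooling set argument shows that in any long enough sequence of
splits of `T`, the bank can combine the part of the bidder being promoted in one split with the
parts of the other bidders in different splits of the sequence. As these splits can be chosen
independently, the same lemma gives a constant fraction of `T` all of which the promoted bidder
receives, however it is split among the bidders not yet promoted. In the end all `k` bidders receive
the same nonempty set, which is impossible with only `d < k` copies of each item. -/

namespace CombAuction

open Finset

section Shattering

variable {α Λ ι : Type*}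

/-- The family `F` of functions *shatters* `T` with respect to the label sets `B`: however a label
set is assigned to each point, some member of `F` takes on all of `T` values in the assigned sets.
With the singletons of `Bool` as label sets this is the shattering of set families. -/
def Shatters (B : ι → Finset Λ) (F : Set (α → Λ)) (T : Finset α) : Prop :=
  ∀ g : α → ι, ∃ f ∈ F, ∀ x ∈ T, f x ∈ B (g x)

theorem Shatters.of_image_update [DecidableEq α] {B : ι → Finset Λ} {F : Set (α → Λ)}
    {T : Finset α} {x : α} {l : Λ} (h : Shatters B ((Function.update · x l) '' F) T) (hx : x ∉ T) :
    Shatters B F T := by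
  intro g
  obtain ⟨_, ⟨f, hf, rfl⟩, hfT⟩ := h g
  refine ⟨f, hf, fun y hy => ?_⟩
  simpa [Function.update_of_ne (ne_of_mem_of_not_mem hy hx)] using hfT y hy

theorem Shatters.insert_of_forall_exists_update [DecidableEq α] {B : ι → Finset Λ}
    {F G : Set (α → Λ)} {T : Finset α} {x : α} (h : Shatters B G T)
    (hG : ∀ f ∈ G, ∀ j, ∃ l ∈ B j, Function.update f x l ∈ F) (hx : x ∉ T) :
    Shatters B F (insert x T) := by
  intro g
  obtain ⟨f, hf, hfT⟩ := h g
  obtain ⟨l, hl, hlF⟩ := hG f hf (g x)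
  refine ⟨_, hlF, fun y hy => ?_⟩
  rcases mem_insert.1 hy with rfl | hy
  · simpa using hl
  · simpa [Function.update_of_ne (ne_of_mem_of_not_mem hy hx)] using hfT y hy

section

variable [Fintype Λ] {B : ι → Finset Λ} {a b : ℝ}

open Classical in
theorem card_add_card_le_of_forall_update_notMem {F : Finset (α → Λ)} {x : α}
    {l₀ : Λ} {g : α → Λ} {L : Finset Λ} (hL : ∀ l ∈ L, Function.update g x l ∉ F) :
    #{f ∈ F | Function.update f x l₀ = g} + #L ≤ Fintype.card Λ := by
  have update_apply : ∀ f ∈ F, Function.update f x l₀ = g → Function.update g x (f x) = f := by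
    rintro f - rfl
    simp
  have hinj : Set.InjOn (fun f : α → Λ => f x) {f ∈ F | Function.update f x l₀ = g} := by
    intro f hf f' hf' h
    rw [← update_apply f hf.1 hf.2, ← update_apply f' hf'.1 hf'.2]
    exact congrArg (Function.update g x) h
  have hdisj : Disjoint ({f ∈ F | Function.update f x l₀ = g}.image fun f => f x) L := by
    simp only [disjoint_left, mem_image, mem_filter]
    rintro _ ⟨f, ⟨hf, hfg⟩, rfl⟩ hfL
    exact hL _ hfL ((update_apply f hf hfg).symm ▸ hf)
  rw [← card_image_of_injOn (by simpa using hinj), ← card_union_of_disjoint hdisj]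
  exact card_le_univ _

open Classical in
theorem card_le_mul_card_image_update_add_mul_card_filter (hab : Fintype.card Λ ≤ a + b)
    (hB : ∀ j, b ≤ #(B j)) (F : Finset (α → Λ)) (x : α) (l₀ : Λ) :
    (#F : ℝ) ≤ a * #(F.image (Function.update · x l₀)) +
      b * #{g ∈ F.image (Function.update · x l₀) | ∀ j, ∃ l ∈ B j, Function.update g x l ∈ F} := by
  have hfiber : ∀ g ∈ F.image (Function.update · x l₀),
      (#{f ∈ F | Function.update f x l₀ = g} : ℝ) ≤
        a + b * if ∀ j, ∃ l ∈ B j, Function.update g x l ∈ F then 1 else 0 := by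
    intro g _
    split_ifs with h
    · have : (#{f ∈ F | Function.update f x l₀ = g} : ℝ) + #(∅ : Finset Λ) ≤ Fintype.card Λ := by
        exact_mod_cast card_add_card_le_of_forall_update_notMem (F := F) (x := x) (l₀ := l₀)
          (g := g) fun l hl => absurd hl (notMem_empty l)
      simp only [card_empty, Nat.cast_zero] at this
      linarith
    · push Not at h
      obtain ⟨j, hj⟩ := h
      have : (#{f ∈ F | Function.update f x l₀ = g} : ℝ) + #(B j) ≤ Fintype.card Λ := by
        exact_mod_cast card_add_card_le_of_forall_update_notMem hj
      linarith [hB j]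
  rw [card_eq_sum_card_image (Function.update · x l₀) F, Nat.cast_sum]
  refine (sum_le_sum hfiber).trans_eq ?_
  rw [sum_add_distrib, ← mul_sum, sum_boole, sum_const, nsmul_eq_mul, mul_comm a]

open Classical in
theorem mul_sum_add_mul_sum_le_sum_powerset_insert (ha : 0 ≤ a) (hb : 0 ≤ b) {x : α}
    {T : Finset α} (hx : x ∉ T) {P Q R : Finset α → Prop} (hP : ∀ S ⊆ T, P S → R S)
    (hQ : ∀ S ⊆ T, Q S → R (insert x S)) :
    a * (∑ S ∈ T.powerset with P S, b ^ #S * a ^ (#T - #S)) +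
        b * ∑ S ∈ T.powerset with Q S, b ^ #S * a ^ (#T - #S) ≤
      ∑ S ∈ (insert x T).powerset with R S, b ^ #S * a ^ (#(insert x T) - #S) := by
  simp only [sum_filter, mul_sum]
  rw [sum_powerset_insert hx, card_insert_of_notMem hx]
  refine add_le_add (sum_le_sum fun S hS => ?_) (sum_le_sum fun S hS => ?_) <;>
    rw [mem_powerset] at hS
  · rw [Nat.sub_add_comm (card_le_card hS)]
    by_cases hPS : P S
    · rw [if_pos hPS, if_pos (hP S hS hPS)]
      exact le_of_eq (by ring)
    · rw [if_neg hPS, mul_zero]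
      positivity
  · rw [card_insert_of_notMem fun hxS => hx (hS hxS), Nat.add_sub_add_right]
    by_cases hQS : Q S
    · rw [if_pos hQS, if_pos (hQ S hS hQS)]
      exact le_of_eq (by ring)
    · rw [if_neg hQS, mul_zero]
      positivity

open Classical in
/-- The proof is Pajor's: restrict to `T` minus a point `x`. The restrictions shatter only sets that
`F` shatters, and those with an extension in `F` into each label set only sets that `F` shatters
together with `x`. -/
theorem card_le_sum_shatters (ha : 0 ≤ a) (hb : 0 ≤ b) (hab : Fintype.card Λ ≤ a + b)
    (hB : ∀ j, b ≤ #(B j)) (f₀ : α → Λ) (T : Finset α) :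
    ∀ F : Finset (α → Λ), (∀ f ∈ F, ∀ x ∉ T, f x = f₀ x) →
      (#F : ℝ) ≤ ∑ S ∈ T.powerset with Shatters B (F : Set (α → Λ)) S, b ^ #S * a ^ (#T - #S) := by
  induction T using Finset.induction_on with
  | empty =>
    intro F hF
    rcases F.eq_empty_or_nonempty with rfl | ⟨f, hf⟩
    · exact (Nat.cast_zero.trans_le (sum_nonneg fun S _ => by positivity))
    · have hF1 : #F ≤ 1 := card_le_one.2 fun f hf f' hf' => funext fun x =>
        (hF f hf x (notMem_empty x)).trans (hF f' hf' x (notMem_empty x)).symm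
      have hempty : Shatters B (F : Set (α → Λ)) ∅ := fun _ => ⟨f, hf, by simp⟩
      simpa [sum_filter, hempty] using hF1
  | insert x T hx ih =>
    intro F hF
    set U := F.image (Function.update · x (f₀ x)) with hU
    set I := {g ∈ U | ∀ j, ∃ l ∈ B j, Function.update g x l ∈ F}
    have hUT : ∀ f ∈ U, ∀ y ∉ T, f y = f₀ y := by
      intro f hf y hy
      obtain ⟨f, hfF, rfl⟩ := mem_image.1 hf
      rcases eq_or_ne y x with rfl | hyx
      · simp
      · simpa [hyx] using hF f hfF y (by simp [hyx, hy])
    have hUF : ∀ S ⊆ T, Shatters B (U : Set (α → Λ)) S → Shatters B (F : Set (α → Λ)) S :=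
      fun S hS h => Shatters.of_image_update (by simpa [hU] using h) fun hxS => hx (hS hxS)
    have hIF : ∀ S ⊆ T, Shatters B (I : Set (α → Λ)) S →
        Shatters B (F : Set (α → Λ)) (insert x S) :=
      fun S hS h => h.insert_of_forall_exists_update (fun f hf => (mem_filter.1 hf).2)
        fun hxS => hx (hS hxS)
    calc (#F : ℝ) ≤ a * #U + b * #I :=
          card_le_mul_card_image_update_add_mul_card_filter hab hB F x (f₀ x)
      _ ≤ a * (∑ S ∈ T.powerset with Shatters B (U : Set (α → Λ)) S, b ^ #S * a ^ (#T - #S)) +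
          b * ∑ S ∈ T.powerset with Shatters B (I : Set (α → Λ)) S, b ^ #S * a ^ (#T - #S) := by
        gcongr
        · exact ih U hUT
        · exact ih I fun f hf => hUT f (filter_subset _ _ hf)
      _ ≤ ∑ S ∈ (insert x T).powerset with Shatters B (F : Set (α → Λ)) S,
          b ^ #S * a ^ (#(insert x T) - #S) :=
        mul_sum_add_mul_sum_le_sum_powerset_insert ha hb hx hUF hIF

theorem card_le_exp_mul_add_pow_of_shatters (ha : 0 ≤ a) (hb : 0 ≤ b)
    (hab : Fintype.card Λ ≤ a + b) (hB : ∀ j, b ≤ #(B j)) {f₀ : α → Λ} {T : Finset α}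
    {F : Finset (α → Λ)} (hF : ∀ f ∈ F, ∀ x ∉ T, f x = f₀ x) {y : ℝ}
    (hy : ∀ S ⊆ T, Shatters B (F : Set (α → Λ)) S → #S ≤ y) :
    (#F : ℝ) ≤ Real.exp y * (b / 2 + a) ^ #T := by
  classical
  have two_le_exp_one : (2 : ℝ) ≤ Real.exp 1 := by linarith [Real.add_one_le_exp (1 : ℝ)]
  have two_pow_le : ∀ n : ℕ, (n : ℝ) ≤ y → (2 : ℝ) ^ n ≤ Real.exp y := fun n hn =>
    calc (2 : ℝ) ^ n ≤ Real.exp 1 ^ n := by gcongr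
      _ = Real.exp n := by rw [← Real.exp_nat_mul, mul_one]
      _ ≤ Real.exp y := Real.exp_le_exp.2 hn
  calc (#F : ℝ)
      ≤ ∑ S ∈ T.powerset with Shatters B (F : Set (α → Λ)) S, b ^ #S * a ^ (#T - #S) := by
        convert card_le_sum_shatters ha hb hab hB f₀ T F hF
    _ ≤ ∑ S ∈ T.powerset with Shatters B (F : Set (α → Λ)) S,
        Real.exp y * ((b / 2) ^ #S * a ^ (#T - #S)) := by
      refine sum_le_sum fun S hS => ?_
      obtain ⟨hST, hS⟩ := mem_filter.1 hS
      calc b ^ #S * a ^ (#T - #S) = 2 ^ #S * ((b / 2) ^ #S * a ^ (#T - #S)) := by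
            rw [← mul_assoc, ← mul_pow, mul_div_cancel₀ b two_ne_zero]
        _ ≤ Real.exp y * ((b / 2) ^ #S * a ^ (#T - #S)) := by
          gcongr
          exact two_pow_le _ (hy S (mem_powerset.1 hST) hS)
    _ ≤ ∑ S ∈ T.powerset, Real.exp y * ((b / 2) ^ #S * a ^ (#T - #S)) :=
      sum_le_sum_of_subset_of_nonneg (filter_subset _ _) fun S _ _ => by positivity
    _ = Real.exp y * (b / 2 + a) ^ #T := by rw [← mul_sum, sum_pow_mul_eq_add_pow]

end

theorem card_le_exp_sub_mul_pow_of_shatters [Fintype Λ] {B : ι → Finset Λ} {p : ℝ} (hp0 : 0 ≤ p)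
    (hp1 : p ≤ 1) (hB : ∀ j, p * Fintype.card Λ ≤ #(B j)) {f₀ : α → Λ} {T : Finset α}
    {F : Finset (α → Λ)} (hF : ∀ f ∈ F, ∀ x ∉ T, f x = f₀ x) {y : ℝ}
    (hy : ∀ S ⊆ T, Shatters B (F : Set (α → Λ)) S → #S ≤ y) :
    (#F : ℝ) ≤ Real.exp (y - p * #T / 2) * (Fintype.card Λ : ℝ) ^ #T := by
  set q : ℝ := (Fintype.card Λ : ℝ)
  have : 0 ≤ 1 - p := sub_nonneg.2 hp1
  calc (#F : ℝ) ≤ Real.exp y * (p * q / 2 + (1 - p) * q) ^ #T :=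
        card_le_exp_mul_add_pow_of_shatters (by positivity) (by positivity)
          (le_of_eq (by ring)) hB hF hy
    _ = Real.exp y * ((1 - p / 2) ^ #T * q ^ #T) := by rw [← mul_pow]; ring
    _ ≤ Real.exp y * (Real.exp (-(p / 2)) ^ #T * q ^ #T) := by
      gcongr
      · linarith
      · exact Real.one_sub_le_exp_neg _
    _ = Real.exp (y - p * #T / 2) * q ^ #T := by
      rw [← Real.exp_nat_mul, ← mul_assoc, ← Real.exp_add]
      ring_nf

theorem exists_subset_shatters_of_cover {V : Type*} {ι : V → Type*} [Finite α] [Fintype Λ]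
    [Nonempty Λ] [Fintype V] (F : V → Set (α → Λ)) (hF : ∀ f, ∃ u, f ∈ F u)
    (B : ∀ u, ι u → Finset Λ) {p : ℝ} (hp0 : 0 ≤ p) (hp1 : p ≤ 1)
    (hB : ∀ u j, p * Fintype.card Λ ≤ #(B u j)) {T : Finset α}
    (hV : Real.log (Fintype.card V) < p * #T / 4) :
    ∃ u, ∃ S ⊆ T, p * #T / 4 ≤ #S ∧ Shatters (B u) (F u) S := by
  classical
  have := Fintype.ofFinite α
  by_contra! hsmall
  obtain ⟨f₀⟩ : Nonempty (α → Λ) := inferInstance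
  let cube : Finset (α → Λ) := Fintype.piFinset fun x => if x ∈ T then univ else {f₀ x}
  have hcube : ∀ f ∈ cube, ∀ x ∉ T, f x = f₀ x := fun f hf x hx => by
    simpa [hx] using Fintype.mem_piFinset.1 hf x
  have card_cube : #cube = Fintype.card Λ ^ #T := by
    simp [cube, Fintype.card_piFinset, apply_ite]
  have card_part : ∀ u, (#{f ∈ cube | f ∈ F u} : ℝ) ≤
      Real.exp (-(p * #T / 4)) * (Fintype.card Λ : ℝ) ^ #T := by
    intro u
    rw [show -(p * #T / 4) = p * #T / 4 - p * #T / 2 by ring]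
    refine card_le_exp_sub_mul_pow_of_shatters hp0 hp1 (hB u)
      (fun f hf => hcube f (mem_filter.1 hf).1) fun S hST hS => ?_
    by_contra! hlt
    refine hsmall u S hST hlt.le fun g => ?_
    obtain ⟨f, hf, hfS⟩ := hS g
    exact ⟨f, (mem_filter.1 hf).2, hfS⟩
  have cover : cube ⊆ univ.biUnion fun u => {f ∈ cube | f ∈ F u} := fun f hf => by
    simpa [hf] using hF f
  have hV0 : (0 : ℝ) < Fintype.card V := Nat.cast_pos.2 (Fintype.card_pos_iff.2 ⟨(hF f₀).choose⟩)
  refine lt_irrefl ((Fintype.card Λ : ℝ) ^ #T) ?_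
  calc (Fintype.card Λ : ℝ) ^ #T = #cube := by rw [card_cube, Nat.cast_pow]
    _ ≤ ∑ u, (#{f ∈ cube | f ∈ F u} : ℝ) := by
      exact_mod_cast (card_le_card cover).trans card_biUnion_le
    _ ≤ ∑ _u : V, Real.exp (-(p * #T / 4)) * (Fintype.card Λ : ℝ) ^ #T :=
      sum_le_sum fun u _ => card_part u
    _ = Fintype.card V * Real.exp (-(p * #T / 4)) * (Fintype.card Λ : ℝ) ^ #T := by
      rw [sum_const, nsmul_eq_mul, card_univ, mul_assoc]
    _ < Real.exp (p * #T / 4) * Real.exp (-(p * #T / 4)) * (Fintype.card Λ : ℝ) ^ #T := by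
      have : 0 < Fintype.card Λ := Fintype.card_pos
      gcongr
      exact (Real.log_lt_iff_lt_exp hV0).1 hV
    _ = (Fintype.card Λ : ℝ) ^ #T := by rw [← Real.exp_add, add_neg_cancel, Real.exp_zero, one_mul]

/-- `(l, l ∘ u)` determines `l` after `l` is overwritten by `l₀` on the range of `u`. -/
theorem card_fun_le_card_comp_eq_mul {κ U : Type*} [Fintype κ] [Fintype U] [Fintype Λ]
    [DecidableEq U] [DecidableEq Λ] (u : κ → U) (l₀ : U → Λ) :
    Fintype.card (U → Λ) ≤
      #{l : U → Λ | ∀ i, l (u i) = l₀ (u i)} * Fintype.card Λ ^ Fintype.card κ := by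
  classical
  rw [← Fintype.card_fun, ← card_univ, ← card_univ (α := κ → Λ), ← card_product]
  refine card_le_card_of_injOn (fun l => ((Set.range u).piecewise l₀ l, l ∘ u)) ?_ ?_
  · intro l _
    simp
  · intro l _ l' _ h
    obtain ⟨hoff, hon⟩ := Prod.mk.inj h
    funext w
    by_cases hw : w ∈ Set.range u
    · obtain ⟨i, rfl⟩ := hw
      exact congrFun hon i
    · simpa [hw] using congrFun hoff w

end Shattering

namespace Protocol

variable {ι V Out : Type}

/-- The sequence of answers of the parties when the protocol runs on the inputs `v`. The parties
asked are not recorded, since the earlier answers determine them. -/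
def transcript : Protocol ι V Out → (ι → V) → List Bool
  | output _, _ => []
  | ask i q next, v => q (v i) :: (next (q (v i))).transcript v

theorem length_transcript (P : Protocol ι V Out) (v : ι → V) :
    (P.transcript v).length = P.bits v := by
  induction P with
  | output o => rfl
  | ask i q next ih => simp only [transcript, bits, List.length_cons, ih]

theorem result_eq_of_transcript_eq (P : Protocol ι V Out) {x y z : ι → V}
    (h : P.transcript x = P.transcript y) (hz : ∀ i, z i = x i ∨ z i = y i) :
    P.result z = P.result x := by
  induction P with
  | output o => rfl
  | ask i q next ih =>
    obtain ⟨hq, hnext⟩ := List.cons.inj h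
    rw [← hq] at hnext
    have hqz : q (z i) = q (x i) := by rcases hz i with hi | hi <;> simp only [hi, hq]
    simpa only [result, hqz] using ih _ hnext

theorem exists_ne_transcript_eq (P : Protocol ι V Out) {κ : Type*} [Fintype κ] {N : ℕ}
    (hN : 2 ^ N ≤ Fintype.card κ) {x : κ → ι → V} (hx : ∀ a, P.bits (x a) < N) :
    ∃ a a', a ≠ a' ∧ P.transcript (x a) = P.transcript (x a') := by
  let code : κ → Σ ℓ : Fin N, List.Vector Bool ℓ := fun a =>
    ⟨⟨P.bits (x a), hx a⟩, P.transcript (x a), P.length_transcript (x a)⟩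
  have card_codes : Fintype.card (Σ ℓ : Fin N, List.Vector Bool ℓ) < 2 ^ N := by
    simp only [Fintype.card_sigma, card_vector, Fintype.card_bool]
    rw [Fin.sum_univ_eq_sum_range (2 ^ ·)]
    exact Nat.geomSum_lt le_rfl fun ℓ hℓ => mem_range.1 hℓ
  obtain ⟨a, a', hne, hcode⟩ := Fintype.exists_ne_map_eq_of_card_lt code (card_codes.trans_le hN)
  exact ⟨a, a', hne, congrArg (fun c => c.2.toList) hcode⟩

end Protocol

variable {n m : ℕ}

section Demand

/-- The bundle `S` satisfies a bidder whose demand is `𝒜`, i.e. who wants any one of the bundles in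
`𝒜`. The empty bundle satisfies no demand, whatever `𝒜` is. -/
def MeetsDemand (S : Finset (Fin m)) (𝒜 : Set (Finset (Fin m))) : Prop :=
  S.Nonempty ∧ ∃ A ∈ 𝒜, A ⊆ S

theorem meetsDemand_singleton {S A : Finset (Fin m)} :
    MeetsDemand S {A} ↔ S.Nonempty ∧ A ⊆ S := by
  simp [MeetsDemand]

theorem not_meetsDemand_empty (S : Finset (Fin m)) : ¬ MeetsDemand S ∅ := by
  simp [MeetsDemand]

theorem MeetsDemand.mono {S : Finset (Fin m)} {𝒜 𝒜' : Set (Finset (Fin m))}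
    (h : MeetsDemand S 𝒜) (h𝒜 : ∀ A ∈ 𝒜, ∃ A' ∈ 𝒜', A' ⊆ A) : MeetsDemand S 𝒜' := by
  obtain ⟨hS, A, hA, hAS⟩ := h
  obtain ⟨A', hA', hA'A⟩ := h𝒜 A hA
  exact ⟨hS, A', hA', hA'A.trans hAS⟩

open Classical in
/-- The valuation of a bidder whose demand is `𝒜`. -/
noncomputable def wants (𝒜 : Set (Finset (Fin m))) : MultiMinded m where
  val :=
    { toFun := fun S => if MeetsDemand S 𝒜 then 1 else 0
      map_empty' := by simp [MeetsDemand]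
      mono' := fun S T hST => by
        dsimp only
        split_ifs with hS hT
        · exact le_rfl
        · obtain ⟨hS, A, hA, hAS⟩ := hS
          exact absurd ⟨hS.mono hST, A, hA, hAS.trans hST⟩ hT
        · exact zero_le_one
        · exact le_rfl }
  property := fun S => (ite_eq_or_eq _ _ _).symm

variable {K : Finset (Fin n)}

/-- The valuations under which each bidder `j ∈ K` has the demand `𝒜 j`, and the other bidders value
every bundle at `0`. -/
noncomputable def bids (𝒜 : K → Set (Finset (Fin m))) : Fin n → MultiMinded m :=
  fun i => wants (if h : i ∈ K then 𝒜 ⟨i, h⟩ else ∅)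

open Classical in
theorem welfare_bids (𝒜 : K → Set (Finset (Fin m))) (S : Bundles n m) :
    welfare (fun i => (bids 𝒜 i : Valuation m)) S = #{j : K | MeetsDemand (S j) (𝒜 j)} := by
  have hK : ∀ j : K, (bids 𝒜 j : Valuation m) (S j) = if MeetsDemand (S j) (𝒜 j) then 1 else 0 :=
    fun j => by simp [bids, wants]
  have hKc : ∀ i ∉ K, (bids 𝒜 i : Valuation m) (S i) = 0 :=
    fun i hi => by simp [bids, wants, hi, not_meetsDemand_empty]
  calc welfare (fun i => (bids 𝒜 i : Valuation m)) S
      = ∑ i ∈ K, (bids 𝒜 i : Valuation m) (S i) :=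
        (sum_subset (subset_univ K) fun i _ hi => hKc i hi).symm
    _ = ∑ j : K, (bids 𝒜 j : Valuation m) (S j) := (sum_coe_sort K _).symm
    _ = #{j : K | MeetsDemand (S j) (𝒜 j)} := by simp only [hK, sum_boole]

/-- Some member of the bank `H` meets the demands of all the bidders in `K` at once. -/
def Accommodates (H : Set (Bundles n m)) (𝒜 : K → Set (Finset (Fin m))) : Prop :=
  ∃ S ∈ H, ∀ j : K, MeetsDemand (S j) (𝒜 j)

variable {H : Set (Bundles n m)} {𝒜 : K → Set (Finset (Fin m))}

theorem Accommodates.mono {𝒜' : K → Set (Finset (Fin m))} (h : Accommodates H 𝒜)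
    (h𝒜 : ∀ j, ∀ A ∈ 𝒜 j, ∃ A' ∈ 𝒜' j, A' ⊆ A) : Accommodates H 𝒜' := by
  obtain ⟨S, hS, hS𝒜⟩ := h
  exact ⟨S, hS, fun j => (hS𝒜 j).mono (h𝒜 j)⟩

theorem Accommodates.exists_mem (h : Accommodates H 𝒜) :
    ∃ X : K → Finset (Fin m), (∀ j, X j ∈ 𝒜 j) ∧ Accommodates H fun j => {X j} := by
  obtain ⟨S, hS, hS𝒜⟩ := h
  choose X hX hXS using fun j => (hS𝒜 j).2
  exact ⟨X, hX, S, hS, fun j => meetsDemand_singleton.2 ⟨(hS𝒜 j).1, hXS j⟩⟩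

end Demand

section MaximalInRange

/-- The output of `M` always belongs to the bank `H`, and its social welfare is maximal in `H`. -/
def IsMaximalIn {F : Set (Valuation m)} (M : Mechanism n m F) (H : Set (Bundles n m)) : Prop :=
  ∀ v : Fin n → F, M.bundles v ∈ H ∧
    ∀ S ∈ H, welfare (fun i => (v i : Valuation m)) S ≤
      welfare (fun i => (v i : Valuation m)) (M.bundles v)

variable {M : Mechanism n m (MultiMinded m)} {H : Set (Bundles n m)} {K : Finset (Fin n)}

theorem IsMaximalIn.meetsDemand_bundles (hM : IsMaximalIn M H) {𝒜 : K → Set (Finset (Fin m))}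
    (h : Accommodates H 𝒜) (j : K) : MeetsDemand (M.bundles (bids 𝒜) j) (𝒜 j) := by
  classical
  obtain ⟨S, hS, hS𝒜⟩ := h
  have hle := (hM (bids 𝒜)).2 S hS
  rw [welfare_bids, welfare_bids, filter_true_of_mem fun j _ => hS𝒜 j, Nat.cast_le] at hle
  have hall := eq_of_subset_of_card_le (filter_subset _ _) hle
  exact filter_eq_self.1 hall j (mem_univ j)

/-- The inputs `bids (𝒜 c)` form a fooling set. If two of them had the same transcript, both ways to
mix them would lead to the output on `bids (𝒜 c)` as well: from one mix, this output meets the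
demand of bidder `e`, and from the other those of the remaining bidders. -/
theorem IsMaximalIn.exists_le_bits (hM : IsMaximalIn M H) (e : K) {κ : Type*} [Fintype κ] {N : ℕ}
    (hN : 2 ^ N ≤ Fintype.card κ) (𝒜 : κ → K → Set (Finset (Fin m)))
    (hno : ∀ c, ¬ Accommodates H (𝒜 c))
    (hyes : ∀ c c', c ≠ c' → Accommodates H (Function.update (𝒜 c') e (𝒜 c e))) :
    ∃ v, N ≤ M.bits v := by
  by_contra! hlt
  obtain ⟨c, c', hne, htr⟩ :=
    M.exists_ne_transcript_eq hN (x := fun c => bids (𝒜 c)) fun c => hlt _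
  have bundles_eq : ∀ ℬ : K → Set (Finset (Fin m)), (∀ j, ℬ j = 𝒜 c j ∨ ℬ j = 𝒜 c' j) →
      M.bundles (bids ℬ) = M.bundles (bids (𝒜 c)) := by
    intro ℬ hℬ
    refine congrArg Prod.fst (M.result_eq_of_transcript_eq htr fun i => ?_)
    by_cases hi : i ∈ K
    · simp only [bids, hi, dif_pos]
      exact (hℬ ⟨i, hi⟩).imp (congrArg wants) (congrArg wants)
    · simp [bids, hi]
  refine hno c ⟨M.bundles (bids (𝒜 c)), (hM _).1, fun j => ?_⟩
  by_cases hj : j = e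
  · have := hM.meetsDemand_bundles (hyes c c' hne) j
    rw [bundles_eq] at this
    · simpa [hj] using this
    · intro i
      by_cases hi : i = e <;> simp [hi]
  · have := hM.meetsDemand_bundles (hyes c' c hne.symm) j
    rw [bundles_eq] at this
    · simpa [hj] using this
    · intro i
      by_cases hi : i = e <;> simp [hi]

end MaximalInRange

section Spreading

variable {M : Mechanism n m (MultiMinded m)} {H : Set (Bundles n m)} {K : Finset (Fin n)}

/-- The bank `H` spreads the items of `T` among the bidders in `K`, with all of `T` for those in
`E`: however `T` is split among the bidders in `K`, a member of `H` gives each bidder in `E` all of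
`T` and each other bidder in `K` its part of `T`, and leaves no bidder in `K` without items. -/
def Spreads (H : Set (Bundles n m)) {K : Finset (Fin n)} (E : Finset K) (T : Finset (Fin m)) :
    Prop :=
  ∀ g : Fin m → K, Accommodates H fun j : K => {{x ∈ T | j ∈ E ∨ g x = j}}

theorem Spreads.eq_empty {d : ℕ} (hH : ∀ S ∈ H, IsDuplicateAllocation d S) (hK : d < #K)
    {T : Finset (Fin m)} (hT : Spreads H (univ : Finset K) T) : T = ∅ := by
  by_contra! hne
  obtain ⟨x, hx⟩ := hne
  obtain ⟨j, hj⟩ := card_pos.1 (Nat.zero_lt_of_lt hK)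
  obtain ⟨S, hS, hST⟩ := hT fun _ => ⟨j, hj⟩
  have hKx : K ⊆ univ.filter fun i => x ∈ S i := fun i hi =>
    mem_filter.2 ⟨mem_univ i, (meetsDemand_singleton.1 (hST ⟨i, hi⟩)).2 (mem_filter.2 (by simpa))⟩
  exact (hK.trans_le (card_le_card hKx)).not_ge (hH S hS x)

/-- The fooling set: on the word `c`, bidder `e` wants its part in any of the splits `(i, c i)`, and
the others want their parts in any of the splits `(i, !c i)`. A member of the bank that meets these
demands uses a split for `e` that it uses for nobody else. If the words `c` and `c'` differ at `i`,
then the mixed demands can be met by the single split `(i, c i)`. -/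
theorem Spreads.exists_accommodates_of_bits_lt (hM : IsMaximalIn M H) {E : Finset K}
    {T : Finset (Fin m)} (hT : Spreads H E T) {N : ℕ} (hN : ∀ v, M.bits v < N) (e : K)
    (f : Fin m → Fin N × Bool → K) :
    ∃ u : K → Fin N × Bool, (∀ j ≠ e, u j ≠ u e) ∧
      Accommodates H fun j => {{x ∈ T | j ∈ E ∨ f x (u j) = j}} := by
  by_contra! hcon
  let part (j : K) (u : Fin N × Bool) : Finset (Fin m) := {x ∈ T | j ∈ E ∨ f x u = j}
  let demand (c : Fin N → Bool) (j : K) : Set (Finset (Fin m)) :=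
    {A | ∃ u : Fin N × Bool, (c u.1 = u.2 ↔ j = e) ∧ part j u = A}
  have hno : ∀ c, ¬ Accommodates H (demand c) := by
    intro c hc
    obtain ⟨X, hX, hXH⟩ := hc.exists_mem
    choose u hu huX using hX
    have hue : ∀ j ≠ e, u j ≠ u e := fun j hj huj => hj ((hu j).1 (huj ▸ (hu e).2 rfl))
    exact hcon u hue (by simpa only [← huX] using hXH)
  have hyes : ∀ c c', c ≠ c' →
      Accommodates H (Function.update (demand c') e (demand c e)) := by
    intro c c' hne
    obtain ⟨i, hi⟩ := Function.ne_iff.1 hne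
    refine (hT fun x => f x (i, c i)).mono fun j A hA => ⟨A, ?_, subset_rfl⟩
    rw [Set.mem_singleton_iff.1 hA]
    rcases eq_or_ne j e with rfl | hj
    · rw [Function.update_self]
      exact ⟨(i, c i), by simp, rfl⟩
    · rw [Function.update_of_ne hj]
      exact ⟨(i, c i), by simp [hj, hi.symm], rfl⟩
  obtain ⟨v, hv⟩ := hM.exists_le_bits e (N := N) (by simp) demand hno hyes
  exact absurd (hN v) hv.not_gt

theorem Spreads.exists_insert (hM : IsMaximalIn M H) {E : Finset K} {T : Finset (Fin m)}
    (hT : Spreads H E T) {N : ℕ} (hN : ∀ v, M.bits v < N) (e : K)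
    (hcard : #K * Real.log (2 * N) < #T / (4 * #K ^ #K)) :
    ∃ T' : Finset (Fin m), (#T / (4 * #K ^ #K) : ℝ) ≤ #T' ∧ Spreads H (insert e E) T' := by
  have : Nonempty K := ⟨e⟩
  have hK : 1 ≤ (#K : ℝ) ^ #K := one_le_pow₀ (Nat.one_le_cast.2 (card_pos.2 ⟨(e : Fin n), e.2⟩))
  have hp : ((#K : ℝ) ^ #K)⁻¹ * #T / 4 = #T / (4 * #K ^ #K) := by
    field_simp
  have log_card : Real.log (Fintype.card (K → Fin N × Bool)) = #K * Real.log (2 * N) := by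
    simp [mul_comm]
  obtain ⟨u, T', hT'T, hT', hsh⟩ := exists_subset_shatters_of_cover (T := T)
    (p := ((#K : ℝ) ^ #K)⁻¹)
    (fun u : K → Fin N × Bool => {f : Fin m → Fin N × Bool → K | (∀ j ≠ e, u j ≠ u e) ∧
      Accommodates H fun j => {{x ∈ T | j ∈ E ∨ f x (u j) = j}}})
    (hT.exists_accommodates_of_bits_lt hM hN e)
    (fun u (j : K) => {l | ∀ i, l (u i) = Function.update (fun _ => j) (u e) e (u i)})
    (by positivity) (inv_le_one_of_one_le₀ hK)
    (fun u j => by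
      rw [inv_mul_le_iff₀ (by positivity), mul_comm]
      exact_mod_cast (card_fun_le_card_comp_eq_mul u _).trans_eq (by rw [Fintype.card_coe]))
    (by rwa [log_card, hp])
  refine ⟨T', hp ▸ hT', fun g => ?_⟩
  obtain ⟨f, ⟨hue, hf⟩, hfg⟩ := hsh g
  refine hf.mono fun j A hA => ⟨_, rfl, ?_⟩
  rw [Set.mem_singleton_iff.1 hA]
  intro x hx
  obtain ⟨hxT', hxj⟩ := mem_filter.1 hx
  have hfx : ∀ i, f x (u i) = Function.update (fun _ => g x) (u e) e (u i) :=
    (mem_filter.1 (hfg x hxT')).2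
  refine mem_filter.2 ⟨hT'T hxT', ?_⟩
  rcases eq_or_ne j e with rfl | hj
  · exact Or.inr ((hfx j).trans (Function.update_self ..))
  · refine hxj.imp (fun hjE => (mem_insert.1 hjE).resolve_left hj) fun hgj => ?_
    rw [hfx, Function.update_of_ne (hue j hj), hgj]

theorem Spreads.exists_of_empty (hM : IsMaximalIn M H) {T : Finset (Fin m)}
    (hT : Spreads H (∅ : Finset K) T) {N : ℕ} (hN : ∀ v, M.bits v < N)
    (hcard : #K * Real.log (2 * N) < #T / (4 * #K ^ #K) ^ #K) (E : Finset K) :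
    ∃ T' : Finset (Fin m), (#T / (4 * #K ^ #K) ^ #E : ℝ) ≤ #T' ∧ Spreads H E T' := by
  induction E using Finset.induction_on with
  | empty => exact ⟨T, by simp, hT⟩
  | insert e E he ih =>
    obtain ⟨T₁, hT₁, hs₁⟩ := ih
    have hK : 1 ≤ (#K : ℝ) ^ #K :=
      one_le_pow₀ (Nat.one_le_cast.2 (card_pos.2 ⟨(e : Fin n), e.2⟩))
    set q : ℝ := 4 * #K ^ #K
    have hq : 1 ≤ q := by linarith
    have hEK : #(insert e E) ≤ #K := (card_le_univ _).trans_eq (Fintype.card_coe K)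
    have hstep : #T / q ^ #(insert e E) ≤ #T₁ / q := by
      rw [card_insert_of_notMem he, pow_succ, ← div_div]
      gcongr
    obtain ⟨T₂, hT₂, hs₂⟩ := hs₁.exists_insert hM hN e <|
      calc #K * Real.log (2 * N) < #T / q ^ #K := hcard
        _ ≤ #T / q ^ #(insert e E) := by gcongr
        _ ≤ #T₁ / q := hstep
    exact ⟨T₂, hstep.trans hT₂, hs₂⟩

variable {α : ℝ}

theorem exists_subset_image_meetsDemand (hα : M.HasApproxRatio α) (hα0 : 0 < α)
    (h : Fin m → Fin n) :
    ∃ v, ∃ K ⊆ univ.image h, #(univ.image h) ≤ α * #K ∧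
      ∀ j ∈ K, MeetsDemand (M.bundles v j) {univ.filter fun x => h x = j} := by
  classical
  let S₀ : Bundles n m := fun i => {x | h x = i}
  have hS₀ : IsAllocation S₀ := fun i i' hne => disjoint_left.2 fun x hx hx' =>
    hne ((mem_filter.1 hx).2.symm.trans (mem_filter.1 hx').2)
  let 𝒜 : univ.image h → Set (Finset (Fin m)) := fun j => {S₀ j}
  have meets : ∀ j : univ.image h, MeetsDemand (S₀ j) (𝒜 j) := by
    rintro ⟨j, hj⟩
    obtain ⟨x, -, rfl⟩ := mem_image.1 hj
    exact meetsDemand_singleton.2 ⟨⟨x, by simp [S₀]⟩, subset_rfl⟩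
  have hle := hα (bids 𝒜) S₀ hS₀
  rw [welfare_bids, welfare_bids, filter_true_of_mem fun j _ => meets j, card_univ,
    Fintype.card_coe, one_div, inv_mul_le_iff₀ hα0] at hle
  refine ⟨bids 𝒜, (univ.filter fun j : univ.image h => MeetsDemand (M.bundles (bids 𝒜) j) (𝒜 j)).map
    (Function.Embedding.subtype _), map_subtype_subset _, by rwa [card_map], fun i hi => ?_⟩
  obtain ⟨j, hj, rfl⟩ := mem_map.1 hi
  exact (mem_filter.1 hj).2

theorem one_le_of_hasApproxRatio (hα : M.HasApproxRatio α) (hα0 : 0 < α) (hn : 0 < n)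
    (hm : 0 < m) : 1 ≤ α := by
  have : Nonempty (Fin m) := ⟨⟨0, hm⟩⟩
  obtain ⟨-, K, hK, hle, -⟩ := exists_subset_image_meetsDemand hα hα0 fun _ => ⟨0, hn⟩
  rw [image_const univ_nonempty] at hK hle
  calc (1 : ℝ) ≤ α * #K := by simpa using hle
    _ ≤ α * 1 := by
      gcongr
      exact_mod_cast card_le_card hK
    _ = α := mul_one α

theorem IsMaximalIn.exists_accommodates_fibers (hM : IsMaximalIn M H) (hα : M.HasApproxRatio α)
    (hα0 : 0 < α) {h : Fin m → Fin n} {k : ℕ} (hk : k * α ≤ #(univ.image h)) :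
    ∃ K ⊆ univ.image h, #K = k ∧ Accommodates H fun j : K => {univ.filter fun x => h x = j} := by
  obtain ⟨v, W, hW, hle, hv⟩ := exists_subset_image_meetsDemand hα hα0 h
  have hkW : k ≤ #W := by
    rw [mul_comm] at hk
    exact_mod_cast le_of_mul_le_mul_left (hk.trans hle) hα0
  obtain ⟨K, hK, rfl⟩ := exists_subset_card_eq hkW
  exact ⟨K, hK.trans hW, rfl, _, (hM v).1, fun j => hv j (hK j.2)⟩

theorem log_card_powersetCard_le {β : Type*} (L : Finset β) (k : ℕ) :
    Real.log #(L.powersetCard k) ≤ k * Real.log #L := by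
  rw [card_powersetCard, ← Real.log_pow]
  rcases (Nat.choose (#L) k).eq_zero_or_pos with h0 | hpos
  · rw [h0, Nat.cast_zero, Real.log_zero, Real.log_pow]
    exact mul_nonneg k.cast_nonneg (Real.log_natCast_nonneg _)
  · exact Real.log_le_log (Nat.cast_pos.2 hpos) (mod_cast Nat.choose_le_pow (#L) k)

/-- The item `r i` is reserved for bidder `i`, so that all the bidders in `L` take part in every
split of the other items. -/
theorem IsMaximalIn.exists_spreads_empty_of_embedding (hM : IsMaximalIn M H)
    (hα : M.HasApproxRatio α) (hα0 : 0 < α) {L : Finset (Fin n)} (hL : L.Nonempty) (r : L ↪ Fin m)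
    {k : ℕ} (hk : k * α ≤ #L) (hlog : k * Real.log #L < #(univ.map r)ᶜ / (4 * #L)) :
    ∃ K : Finset (Fin n), #K = k ∧ ∃ T : Finset (Fin m),
      (#(univ.map r)ᶜ / (4 * #L) : ℝ) ≤ #T ∧ Spreads H (∅ : Finset K) T := by
  classical
  have : Nonempty L := hL.to_subtype
  have hL0 : 0 < #L := card_pos.2 hL
  let owner (f : Fin m → L) : Fin m → L := Function.extend r id f
  have image_owner : ∀ f, (univ.image fun x => (owner f x : Fin n)) = L := fun f => by
    ext i
    refine ⟨fun hi => ?_, fun hi => ?_⟩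
    · obtain ⟨x, -, rfl⟩ := mem_image.1 hi
      exact (owner f x).2
    · exact mem_image.2 ⟨r ⟨i, hi⟩, mem_univ _, by simp [owner, r.injective.extend_apply]⟩
  have hp : (#L : ℝ)⁻¹ * #(univ.map r)ᶜ / 4 = #(univ.map r)ᶜ / (4 * #L) := by field_simp
  obtain ⟨⟨K, hK⟩, T, hT, hcard, hsh⟩ := exists_subset_shatters_of_cover (T := (univ.map r)ᶜ)
    (p := (#L : ℝ)⁻¹) (V := L.powersetCard k)
    (fun K => {f | Accommodates H fun j : K.1 => {univ.filter fun x => (owner f x : Fin n) = j}})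
    (fun f => by
      obtain ⟨K, hKL, hKk, hKH⟩ :=
        hM.exists_accommodates_fibers hα hα0 (hk.trans_eq (by rw [image_owner f]))
      rw [image_owner] at hKL
      exact ⟨⟨K, mem_powersetCard.2 ⟨hKL, hKk⟩⟩, hKH⟩)
    (fun K (j : K.1) => {⟨j, (mem_powersetCard.1 K.2).1 j.2⟩})
    (by positivity) (inv_le_one_of_one_le₀ (Nat.one_le_cast.2 hL0))
    (fun K j => by simp [hL0.ne'])
    (by
      rw [hp, Fintype.card_coe]
      exact (log_card_powersetCard_le L k).trans_lt hlog)
  refine ⟨K, (mem_powersetCard.1 hK).2, T, hp ▸ hcard, fun g => ?_⟩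
  obtain ⟨f, hf, hfg⟩ := hsh g
  refine hf.mono fun j A hA => ⟨_, rfl, ?_⟩
  rw [Set.mem_singleton_iff.1 hA]
  intro x hx
  obtain ⟨hxT, hxj⟩ := mem_filter.1 hx
  have hxr : ¬ ∃ i, r i = x := by simpa using hT hxT
  have hgj : g x = j := hxj.resolve_left (notMem_empty j)
  have hfx : (f x : Fin n) = g x := congrArg Subtype.val (mem_singleton.1 (hfg x hxT))
  simp [owner, Function.extend_apply' _ _ _ hxr, hfx, hgj]

theorem IsMaximalIn.exists_spreads_empty (hM : IsMaximalIn M H) (hα : M.HasApproxRatio α)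
    (hα0 : 0 < α) {t : ℕ} (htn : t ≤ n) {k : ℕ} (hk : k * α ≤ t)
    (hlog : k * Real.log t < (m - t) / (4 * t)) :
    ∃ K : Finset (Fin n), #K = k ∧ ∃ T : Finset (Fin m),
      ((m - t) / (4 * t) : ℝ) ≤ #T ∧ Spreads H (∅ : Finset K) T := by
  have hpos : (0 : ℝ) < (m - t) / (4 * t) :=
    (mul_nonneg k.cast_nonneg (Real.log_natCast_nonneg t)).trans_lt hlog
  have ht0 : 0 < t := by
    by_contra! h0
    simp [Nat.le_zero.1 h0] at hpos
  have htm : t ≤ m := by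
    by_contra! hlt
    exact hpos.not_ge (div_nonpos_of_nonpos_of_nonneg
      (sub_nonpos.2 (Nat.cast_le.2 hlt.le)) (by positivity))
  obtain ⟨L, -, rfl⟩ := exists_subset_card_eq (s := (univ : Finset (Fin n))) (by simpa)
  obtain ⟨r⟩ : Nonempty (L ↪ Fin m) := Function.Embedding.nonempty_of_card_le (by simpa)
  have hcard : (#(univ.map r)ᶜ : ℝ) = m - #L := by
    rw [card_compl, card_map, card_univ, Fintype.card_coe, Fintype.card_fin, Nat.cast_sub htm]
  rw [← hcard] at hlog ⊢
  exact hM.exists_spreads_empty_of_embedding hα hα0 (card_pos.1 ht0) r hk hlog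

theorem exists_le_bits_of_isVCGBased {d k : ℕ} (hdk : d < k) (hM : M.IsVCGBased d)
    (hα : M.HasApproxRatio α) (hα0 : 0 < α) {t N : ℕ} (htn : t ≤ n) (hk : k * α ≤ t)
    (hlog : k * Real.log t < (m - t) / (4 * t))
    (hN : k * Real.log (2 * N) < (m - t) / (4 * t) / (4 * k ^ k) ^ k) :
    ∃ v, N ≤ M.bits v := by
  obtain ⟨H, hH, hmax : IsMaximalIn M H⟩ := hM
  by_contra! hlt
  obtain ⟨K, rfl, T, hT, hs⟩ := hmax.exists_spreads_empty hα hα0 htn hk hlog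
  have hNT : #K * Real.log (2 * N) < #T / (4 * #K ^ #K) ^ #K := hN.trans_le (by gcongr)
  obtain ⟨T', hT', hs'⟩ := hs.exists_of_empty hmax hlt hNT univ
  have hlog0 : 0 ≤ Real.log (2 * N) := by exact_mod_cast Real.log_natCast_nonneg (2 * N)
  rw [hs'.eq_empty hH hdk, card_empty, Nat.cast_zero, card_univ, Fintype.card_coe] at hT'
  exact (hNT.trans_le hT').not_ge (by positivity)

end Spreading

section Asymptotics

open Asymptotics Filter

theorem isLittleO_rpow_rpow_atTop {a b : ℝ} (hab : a < b) :
    (fun x : ℝ => x ^ a) =o[atTop] fun x => x ^ b := by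
  refine (isLittleO_iff_tendsto' ?_).2 ?_
  · filter_upwards [eventually_gt_atTop 0] with x hx h0
    exact absurd h0 (by positivity)
  · refine (tendsto_rpow_neg_atTop (sub_pos.2 hab)).congr' ?_
    filter_upwards [eventually_gt_atTop 0] with x hx
    rw [neg_sub, Real.rpow_sub hx]

theorem eventually_const_mul_lt_of_isLittleO {f g : ℝ → ℝ} (hfg : f =o[atTop] g)
    (hg : ∀ᶠ x in atTop, 0 < g x) (C : ℝ) : ∀ᶠ x in atTop, C * f x < g x := by
  filter_upwards [(hfg.const_mul_left C).bound one_half_pos, hg] with x hx hgx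
  calc C * f x ≤ ‖C * f x‖ := le_abs_self _
    _ ≤ 1 / 2 * ‖g x‖ := hx
    _ = 1 / 2 * g x := by rw [Real.norm_of_nonneg hgx.le]
    _ < g x := by linarith

theorem eventually_rpow_pos (a : ℝ) : ∀ᶠ x : ℝ in atTop, 0 < x ^ a := by
  filter_upwards [eventually_gt_atTop 0] with x hx
  positivity

theorem log_two_mul_natCeil_exp_le {y : ℝ} (hy : 0 ≤ y) :
    Real.log (2 * ⌈Real.exp y⌉₊) ≤ 3 + y := by
  have : (0 : ℝ) < ⌈Real.exp y⌉₊ := Nat.cast_pos.2 (Nat.ceil_pos.2 (Real.exp_pos y))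
  rw [Real.log_le_iff_le_exp (by positivity)]
  calc 2 * (⌈Real.exp y⌉₊ : ℝ) ≤ 2 * (2 * Real.exp y) := by
        gcongr
        exact Nat.ceil_le_two_mul (by linarith [Real.one_le_exp hy])
    _ = (3 + 1) * Real.exp y := by ring
    _ ≤ Real.exp 3 * Real.exp y := by
      gcongr
      exact Real.add_one_le_exp 3
    _ = Real.exp (3 + y) := (Real.exp_add 3 y).symm

theorem eventually_const_mul_rpow_le_natCeil_rpow {a b : ℝ} (hab : a < b) (C : ℝ) :
    ∀ᶠ x : ℝ in atTop, C * x ^ a ≤ ⌈x ^ b⌉₊ := by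
  filter_upwards [eventually_const_mul_lt_of_isLittleO (isLittleO_rpow_rpow_atTop hab)
    (eventually_rpow_pos b) C] with x hx
  exact hx.le.trans (Nat.le_ceil _)

variable {s : ℝ}

theorem eventually_rpow_div_le_sub_natCeil_div (hs0 : 0 < s) (hs1 : s ≤ 1) :
    ∀ᶠ x : ℝ in atTop, x ^ s / 16 ≤ (x - ⌈x ^ (1 - s)⌉₊) / (4 * ⌈x ^ (1 - s)⌉₊) := by
  filter_upwards [(tendsto_rpow_atTop hs0).eventually_ge_atTop 4, eventually_ge_atTop 1]
    with x hxs hx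
  set w : ℝ := x ^ (1 - s)
  have hxw : x ^ s * w = x := by
    rw [← Real.rpow_add (by positivity), add_sub_cancel, Real.rpow_one]
  have hw : 1 ≤ w := Real.one_le_rpow hx (sub_nonneg.2 hs1)
  have hceil : (⌈w⌉₊ : ℝ) ≤ 2 * w := Nat.ceil_le_two_mul (by linarith)
  have : (0 : ℝ) < ⌈w⌉₊ := zero_lt_one.trans_le (hw.trans (Nat.le_ceil w))
  rw [div_le_div_iff₀ (by norm_num) (by positivity)]
  calc x ^ s * (4 * ⌈w⌉₊) ≤ x ^ s * (4 * (2 * w)) := by gcongr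
    _ = 16 * x - 8 * x := by linear_combination 8 * hxw
    _ ≤ 16 * x - 16 * ⌈w⌉₊ := by
      have : 4 * w ≤ x ^ s * w := by gcongr
      linarith
    _ = (x - ⌈w⌉₊) * 16 := by ring

theorem eventually_const_mul_lt_sub_natCeil_div (hs0 : 0 < s) (hs1 : s ≤ 1) {f : ℝ → ℝ}
    (hf : f =o[atTop] fun x => x ^ s) (C : ℝ) :
    ∀ᶠ x : ℝ in atTop, C * f x < (x - ⌈x ^ (1 - s)⌉₊) / (4 * ⌈x ^ (1 - s)⌉₊) := by
  filter_upwards [eventually_rpow_div_le_sub_natCeil_div hs0 hs1,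
    eventually_const_mul_lt_of_isLittleO hf (eventually_rpow_pos s) (16 * C)] with x hx hfx
  linarith

theorem eventually_const_mul_log_natCeil_rpow_lt (hs0 : 0 < s) (hs1 : s ≤ 1) {C : ℝ}
    (hC : 0 ≤ C) :
    ∀ᶠ x : ℝ in atTop, C * Real.log ⌈x ^ (1 - s)⌉₊ <
      (x - ⌈x ^ (1 - s)⌉₊) / (4 * ⌈x ^ (1 - s)⌉₊) := by
  filter_upwards [eventually_const_mul_lt_sub_natCeil_div hs0 hs1 (isLittleO_log_rpow_atTop hs0)
    (2 * C), eventually_ge_atTop 2] with x hlt hx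
  have hx1 : 1 ≤ x ^ (1 - s) := Real.one_le_rpow (by linarith) (sub_nonneg.2 hs1)
  have hceil : (⌈x ^ (1 - s)⌉₊ : ℝ) ≤ x ^ 2 :=
    calc (⌈x ^ (1 - s)⌉₊ : ℝ) ≤ 2 * x ^ (1 - s) :=
          Nat.ceil_le_two_mul (by linarith)
      _ ≤ x * x ^ (1 : ℝ) := by
        gcongr <;> linarith
      _ = x ^ 2 := by rw [Real.rpow_one, sq]
  have : (0 : ℝ) < ⌈x ^ (1 - s)⌉₊ := Nat.cast_pos.2 (Nat.ceil_pos.2 (by positivity))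
  calc C * Real.log ⌈x ^ (1 - s)⌉₊ ≤ C * Real.log (x ^ 2) := by gcongr
    _ = 2 * C * Real.log x := by rw [Real.log_pow, Nat.cast_ofNat]; ring
    _ < _ := hlt

theorem eventually_const_mul_log_natCeil_exp_lt {a : ℝ} (has : a < s) (hs0 : 0 < s) (hs1 : s ≤ 1)
    {C : ℝ} (hC : 0 ≤ C) :
    ∀ᶠ x : ℝ in atTop, C * Real.log (2 * ⌈Real.exp (x ^ a)⌉₊) <
      (x - ⌈x ^ (1 - s)⌉₊) / (4 * ⌈x ^ (1 - s)⌉₊) := by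
  have hconst : (fun _ : ℝ => (3 : ℝ)) =o[atTop] fun x => x ^ s :=
    isLittleO_const_left.2 (Or.inr (tendsto_norm_atTop_atTop.comp (tendsto_rpow_atTop hs0)))
  filter_upwards [eventually_const_mul_lt_sub_natCeil_div hs0 hs1
    (hconst.add (isLittleO_rpow_rpow_atTop has)) C, eventually_ge_atTop 0] with x hlt hx
  refine lt_of_le_of_lt ?_ hlt
  gcongr
  exact log_two_mul_natCeil_exp_le (by positivity)

end Asymptotics

end CombAuction

theorem mainTheorem6 (d : ℕ) (hd : 1 ≤ d) (ε : ℝ) (hε : 0 < ε) :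
    ∃ m₀ : ℕ, ∀ m : ℕ, m₀ ≤ m → ∀ n : ℕ, (m : ℝ) ^ (1 - 3 * ε / 4) ≤ (n : ℝ) →
      ∀ M : CombAuction.Mechanism n m (CombAuction.MultiMinded m),
        CombAuction.Mechanism.IsVCGBased d M →
        CombAuction.Mechanism.HasApproxRatio M ((m : ℝ) ^ (1 - ε)) →
        ∃ v : Fin n → CombAuction.MultiMinded m,
          Real.exp ((m : ℝ) ^ (ε / 2)) ≤ (CombAuction.Protocol.bits M v : ℝ) := by
  rcases le_or_gt ε 1 with hε1 | hε1
  · obtain ⟨k, hdk⟩ : ∃ k, d < k := exists_gt d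
    have hratio := CombAuction.eventually_const_mul_rpow_le_natCeil_rpow
      (by linarith : 1 - ε < 1 - 3 * ε / 4) (k : ℝ)
    have hlog := CombAuction.eventually_const_mul_log_natCeil_rpow_lt
      (by linarith : 0 < 3 * ε / 4) (by linarith) (Nat.cast_nonneg (α := ℝ) k)
    have hbits := CombAuction.eventually_const_mul_log_natCeil_exp_lt
      (by linarith : ε / 2 < 3 * ε / 4) (by linarith) (by linarith)
      (by positivity : 0 ≤ (k : ℝ) * (4 * k ^ k) ^ k)
    obtain ⟨m₀, hm₀⟩ := Filter.eventually_atTop.1 <| tendsto_natCast_atTop_atTop.eventually <|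
      hratio.and <| hlog.and <| hbits.and <| Filter.eventually_gt_atTop 0
    refine ⟨m₀, fun m hm n hn M hM hα => ?_⟩
    obtain ⟨hratio, hlog, hbits, hm0⟩ := hm₀ m hm
    have hk0 : (0 : ℝ) < k := Nat.cast_pos.2 (Nat.zero_lt_of_lt hdk)
    rw [mul_right_comm, ← lt_div_iff₀ (by positivity)] at hbits
    obtain ⟨v, hv⟩ := CombAuction.exists_le_bits_of_isVCGBased hdk hM hα
      (by positivity) (Nat.ceil_le.2 hn) hratio hlog hbits
    exact ⟨v, (Nat.le_ceil _).trans (Nat.cast_le.2 hv)⟩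
  · refine ⟨2, fun m hm n hn M _ hα => ?_⟩
    have hm1 : (1 : ℝ) < m := Nat.one_lt_cast.2 hm
    have hn0 : (0 : ℝ) < n := lt_of_lt_of_le (by positivity) hn
    exact absurd (CombAuction.one_le_of_hasApproxRatio hα (by positivity) (Nat.cast_pos.1 hn0)
      (by omega)) (Real.rpow_lt_one_of_one_lt_of_neg hm1 (by linarith)).not_ge
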